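/- For a root of unity $z\in\mathbb{C}$ and an integer $k\ge 1$ with $(k,z)\neq(1,1)$, let $$\mathrm{Li}_k(z)=\lim_{M\to\infty}\sum_{n=1}^{M}\frac{z^n}{n^k},\qquad \mathrm{ti}_k(z)=\lim_{M\to\infty}\sum_{n=1}^{M}\frac{z^n}{(n-1/2)^k}$$ be the cyclotomic single zeta value and the cyclotomic single $t$-value of weight $k$. For roots of unity $x,y$ and integers $p,q\ge1$ with $(q,y)\ne(1,1)$, the cyclotomic double $S$-value is $$S_{p,q}(x,y)=4\sum_{0<n_1<n_2}\frac{x^{n_1}y^{n_2}}{(2n_1)^p(2n_2-1)^q}:=\lim_{M\to\infty}4\sum_{0<n_1<n_2\le M}\frac{x^{n_1}y^{n_2}}{(2n_1)^p(2n_2-1)^q}.$$ Corollary. Let $x,y$ be roots of unity and $p,q\ge 1$ integers with $(p,x)\neq(1,1)$ and $(q,y)\ne(1,1)$. Then the limits defining $S_{p,q}(x,y)$ and $S_{p,q}(x^{-1},y^{-1})$ exist, and $$S_{p,q}(x,y)-(-1)^{p+q}\,y\,S_{p,q}(x^{-1},y^{-1})$$ is a finite linear combination with rational coefficients of terms $x^{a}y^{b}\,P$,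 where $a,b\in\mathbb{Z}$ and $P$ is a product of finitely many cyclotomic single $t$-values $\mathrm{ti}_k(z)$ and cyclotomic single zeta values $\mathrm{Li}_k(z)$, each with $k\ge1$, $z$ in the multiplicative group generated by $x$ and $y$, and $(k,z)\ne(1,1)$, whose weights $k$ add up to $p+q$. -/

import Mathlib

open Filter Topology

noncomputable section

/-- The finite sum `ζ_n(p; x) = ∑_{k=1}^n x^k / k^p`. -/
def zetaPartial (n p : ℕ) (x : ℂ) : ℂ :=
  ∑ k ∈ Finset.Icc 1 n, x ^ k / (k : ℂ) ^ p

/-- The finite sum `t_n(p; x) = ∑_{k=1}^n x^k / (k - 1/2)^p`. -/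
def tPartial (n p : ℕ) (x : ℂ) : ℂ :=
  ∑ k ∈ Finset.Icc 1 n, x ^ k / ((k : ℂ) - 1 / 2) ^ p

/-- The cyclotomic single zeta value `Li_p(x) = lim_n ζ_n(p; x)`,
for `p ≥ 1`, `x` a root of unity, `(p, x) ≠ (1, 1)`. -/
def cycZeta (p : ℕ) (x : ℂ) : ℂ :=
  limUnder atTop (fun n : ℕ => zetaPartial n p x)

/-- The cyclotomic single `t`-value `ti_p(x) = lim_n t_n(p; x)`,
for `p ≥ 1`, `x` a root of unity, `(p, x) ≠ (1, 1)`. -/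
def cycT (p : ℕ) (x : ℂ) : ℂ :=
  limUnder atTop (fun n : ℕ => tPartial n p x)

/-- The truncation `4 ∑_{0 < n₁ < n₂ ≤ N} x^{n₁} y^{n₂} / ((2 n₁)^p (2 n₂ - 1)^q)` of the
cyclotomic double `S`-value. -/
def doubleSPartial (N p q : ℕ) (x y : ℂ) : ℂ :=
  4 * ∑ n₂ ∈ Finset.Icc 1 N, ∑ n₁ ∈ Finset.Ico 1 n₂,
    x ^ n₁ * y ^ n₂ / ((2 * (n₁ : ℂ)) ^ p * (2 * (n₂ : ℂ) - 1) ^ q)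

/-- The cyclotomic double `S`-value, the limit of its truncations. -/
def doubleS (p q : ℕ) (x y : ℂ) : ℂ :=
  limUnder atTop (fun N : ℕ => doubleSPartial N p q x y)

/-- `IsSingleValueProduct x y w v`: the number `v` is a product of finitely many cyclotomic single
zeta values `Li_k(z)` and single `t`-values `ti_k(z)`, all of them convergent, with arguments `z`
in the group generated by `x` and `y`, whose weights `k` add up to `w`. -/
inductive IsSingleValueProduct (x y : ℂ) : ℕ → ℂ → Prop
  | one : IsSingleValueProduct x y 0 1
  | zeta_mul {w : ℕ} {v : ℂ} (k : ℕ) (a b : ℤ) (hk : 1 ≤ k)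
      (hka : ((k, x ^ a * y ^ b) : ℕ × ℂ) ≠ (1, 1)) (hv : IsSingleValueProduct x y w v) :
      IsSingleValueProduct x y (k + w) (cycZeta k (x ^ a * y ^ b) * v)
  | t_mul {w : ℕ} {v : ℂ} (k : ℕ) (a b : ℤ) (hk : 1 ≤ k)
      (hka : ((k, x ^ a * y ^ b) : ℕ × ℂ) ≠ (1, 1)) (hv : IsSingleValueProduct x y w v) :
      IsSingleValueProduct x y (k + w) (cycT k (x ^ a * y ^ b) * v)

/-- The products of weight `w`, each multiplied by a monomial `x^a y^b` (`a`, `b` integers). -/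
def productTerms (x y : ℂ) (w : ℕ) : Set ℂ :=
  {u | ∃ (a b : ℤ) (v : ℂ), IsSingleValueProduct x y w v ∧ u = x ^ a * y ^ b * v}

end

/-! The sum of x^(-n) y^(k-n) / (n^p (k-n-1/2)^q) over 1 ≤ k ≤ M and nonzero |n| ≤ L (`stripSum`) is
evaluated in two ways.

By rows (k fixed): n and k-n-1/2 add up to k-1/2, which does not depend on n. Partial fractions
therefore leave two-sided single series in n with argument xy. As L → ∞ these tend to single values
independent of k, and then M → ∞ gives a rational combination Q of products
(`exists_tendsto_stripSum`).

By columns (n fixed): the k-sum is a block of consecutive t-terms. Reflecting negative indices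
through m ↦ 1-m produces the factor (-1)^q y and the inverse arguments. In the limit there appear
products of two single values and the sums of x^n/n^p t_n(q;y) and its inverse-argument analogue,
which are the double values up to products. Equating with Q gives the parity relation.

Weight one makes convergence conditional. Partial sums of single series have error O(1/n), the other
factor is O(1/n), and this controls every error sum. A choice L(M) ≥ M replaces an interchange of
limits. -/

/-! ### Single series with an O(1/n) error. -/

/-- The sequence `u` converges to `l` with error `O(1 / n)`. -/
def ConvergesFast (u : ℕ → ℂ) (l : ℂ) : Prop :=
  ∃ C : ℝ, 0 ≤ C ∧ ∀ n : ℕ, ‖u n - l‖ ≤ C * (1 / ((n : ℝ) + 1))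

theorem ConvergesFast.tendsto {u : ℕ → ℂ} {l : ℂ} (h : ConvergesFast u l) :
    Tendsto u atTop (𝓝 l) := by
  obtain ⟨C, -, hC⟩ := h
  rw [tendsto_iff_norm_sub_tendsto_zero]
  refine squeeze_zero (fun _ => norm_nonneg _) hC ?_
  simpa using (tendsto_one_div_add_atTop_nhds_zero_nat (𝕜 := ℝ)).const_mul C

theorem sum_range_inv_mul_succ (n : ℕ) :
    ∑ i ∈ Finset.range n, 1 / (((i : ℝ) + 1) * ((i : ℝ) + 2)) = 1 - 1 / ((n : ℝ) + 1) := by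
  induction n with
  | zero => simp
  | succ n ih =>
    rw [Finset.sum_range_succ, ih]
    have h1 : (n : ℝ) + 1 ≠ 0 := by positivity
    have h2 : (n : ℝ) + 2 ≠ 0 := by positivity
    push_cast
    rw [show (n : ℝ) + 1 + 1 = n + 2 by ring]
    field_simp
    ring

/-- Series with terms `O(1 / n ^ 2)` converge with error `O(1 / n)`. -/
theorem convergesFast_of_norm_le {u : ℕ → ℂ} {K : ℝ}
    (hu : ∀ i : ℕ, ‖u i‖ ≤ K * (1 / (((i : ℝ) + 1) * ((i : ℝ) + 2)))) :
    ∃ l, ConvergesFast (fun n => ∑ i ∈ Finset.range n, u i) l := by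
  have hK : 0 ≤ K := by
    have := (norm_nonneg _).trans (hu 0)
    norm_num at this
    linarith
  have block : ∀ n m : ℕ, n ≤ m →
      ‖∑ i ∈ Finset.range m, u i - ∑ i ∈ Finset.range n, u i‖ ≤ K * (1 / ((n : ℝ) + 1)) := by
    intro n m hnm
    rw [← Finset.sum_Ico_eq_sub _ hnm]
    refine (norm_sum_le _ _).trans ((Finset.sum_le_sum fun i _ => hu i).trans ?_)
    rw [← Finset.mul_sum, Finset.sum_Ico_eq_sub _ hnm, sum_range_inv_mul_succ,
      sum_range_inv_mul_succ]
    refine mul_le_mul_of_nonneg_left ?_ hK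
    have : 0 ≤ 1 / ((m : ℝ) + 1) := by positivity
    linarith
  have hc : CauchySeq (fun n => ∑ i ∈ Finset.range n, u i) := by
    refine cauchySeq_of_le_tendsto_0' (fun n : ℕ => K * (1 / ((n : ℝ) + 1))) ?_ ?_
    · intro n m hnm
      rw [dist_comm, dist_eq_norm]
      exact block n m hnm
    · simpa using (tendsto_one_div_add_atTop_nhds_zero_nat (𝕜 := ℝ)).const_mul K
  obtain ⟨l, hl⟩ := cauchySeq_tendsto_of_complete hc
  refine ⟨l, K, hK, fun n => ?_⟩
  rw [norm_sub_rev]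
  refine le_of_tendsto (hl.sub_const _).norm ?_
  filter_upwards [eventually_ge_atTop n] with m hm
  exact block n m hm

/-- Series which up to a telescoping series have terms `O(1 / n ^ 2)`. -/
theorem convergesFast_of_norm_sub_le {u v : ℕ → ℂ} {K K' : ℝ}
    (hu : ∀ i : ℕ, ‖u i - (v (i + 1) - v i)‖ ≤ K * (1 / (((i : ℝ) + 1) * ((i : ℝ) + 2))))
    (hv : ∀ i : ℕ, ‖v i‖ ≤ K' * (1 / ((i : ℝ) + 1))) :
    ∃ l, ConvergesFast (fun n => ∑ i ∈ Finset.range n, u i) l := by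
  obtain ⟨l, C, hC0, hC⟩ := convergesFast_of_norm_le hu
  have hK : 0 ≤ K' := by simpa using (norm_nonneg _).trans (hv 0)
  refine ⟨l - v 0, C + K', by positivity, fun n => ?_⟩
  have h := hC n
  have e := Finset.sum_range_sub v n
  simp only [Finset.sum_sub_distrib] at h e
  rw [e] at h
  calc _ = ‖(∑ i ∈ Finset.range n, u i - (v n - v 0) - l) + v n‖ := by congr 1; ring
    _ ≤ _ := norm_add_le _ _
    _ ≤ _ := by rw [add_mul]; exact add_le_add h (hv n)

theorem inv_add_le {α : ℝ} (h0 : 0 < α) (h1 : α ≤ 1) (i : ℕ) :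
    1 / ((i : ℝ) + α) ≤ 1 / α * (1 / ((i : ℝ) + 1)) := by
  have : 0 < (i : ℝ) + α := by positivity
  rw [one_div_mul_one_div]
  refine one_div_le_one_div_of_le (by positivity) ?_
  nlinarith [(Nat.cast_nonneg i : (0 : ℝ) ≤ i)]

theorem norm_natCast_add {α : ℝ} (h0 : 0 < α) (i : ℕ) : ‖(i : ℂ) + (α : ℂ)‖ = i + α := by
  have : (i : ℂ) + (α : ℂ) = (((i : ℝ) + α : ℝ) : ℂ) := by push_cast; rfl
  rw [this, Complex.norm_real, Real.norm_of_nonneg (by positivity)]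

/-- Covers zeta (α = 1) and t (α = 1/2) together. In weight one, where z ≠ 1, subtracting the
difference of z^(i+1)/((i+α)(z-1)) leaves O(1/i²), as in Abel summation. -/
theorem convergesFast_lerch {z : ℂ} (hz : ‖z‖ = 1) {k : ℕ} (hk : 1 ≤ k)
    (hkz : ((k, z) : ℕ × ℂ) ≠ (1, 1)) {α : ℝ} (h0 : 0 < α) (h1 : α ≤ 1) :
    ∃ l, ConvergesFast
      (fun n => ∑ i ∈ Finset.range n, z ^ (i + 1) / ((i : ℂ) + (α : ℂ)) ^ k) l := by
  have hne : ∀ i : ℕ, (i : ℂ) + (α : ℂ) ≠ 0 := fun i => by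
    rw [← norm_pos_iff, norm_natCast_add h0]; positivity
  rcases hk.eq_or_lt with rfl | hk2
  · have hz1 : z - 1 ≠ 0 := sub_ne_zero.mpr fun h => hkz (by rw [h])
    refine convergesFast_of_norm_sub_le
      (v := fun i => z ^ (i + 1) / ((i : ℂ) + (α : ℂ)) / (z - 1))
      (K := 1 / ‖z - 1‖ * (1 / α * (1 / α) * 2)) (K' := 1 / ‖z - 1‖ * (1 / α))
      (fun i => ?_) (fun i => ?_)
    · have e : z ^ (i + 1) / ((i : ℂ) + (α : ℂ)) ^ 1 -
          (z ^ (i + 1 + 1) / (((i + 1 : ℕ) : ℂ) + (α : ℂ)) / (z - 1) -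
            z ^ (i + 1) / ((i : ℂ) + (α : ℂ)) / (z - 1)) =
          z ^ (i + 2) * (1 / (z - 1)) *
            (1 / ((i : ℂ) + (α : ℂ)) * (1 / (((i + 1 : ℕ) : ℂ) + (α : ℂ)))) := by
        have ha := hne i
        have hb := hne (i + 1)
        push_cast at hb ⊢
        field_simp
        ring
      rw [e]
      simp only [norm_mul, norm_pow, hz, norm_div, norm_one, one_pow, one_mul]
      rw [norm_natCast_add h0, norm_natCast_add h0, mul_assoc]
      refine mul_le_mul_of_nonneg_left ?_ (by positivity)
      have hb := inv_add_le h0 h1 (i + 1)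
      have hp : 0 ≤ 1 / α := by positivity
      calc _ ≤ (1 / α * (1 / ((i : ℝ) + 1))) * (1 / α * (1 / (((i + 1 : ℕ) : ℝ) + 1))) :=
            mul_le_mul (inv_add_le h0 h1 i) hb (by positivity) (by positivity)
        _ = 1 / α * (1 / α) * (1 / (((i : ℝ) + 1) * ((i : ℝ) + 2))) := by
            push_cast
            rw [show (i : ℝ) + 1 + 1 = i + 2 by ring]
            field_simp
        _ ≤ _ := by
            rw [mul_assoc _ 2]
            refine mul_le_mul_of_nonneg_left ?_ (by positivity)
            have : 0 ≤ 1 / (((i : ℝ) + 1) * ((i : ℝ) + 2)) := by positivity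
            linarith
    · simp only [norm_div, norm_pow, hz, one_pow]
      rw [norm_natCast_add h0, div_eq_mul_one_div, mul_comm, mul_assoc]
      exact mul_le_mul_of_nonneg_left (inv_add_le h0 h1 i) (by positivity)
  -- The factor 2 comes from i + 2 ≤ 2(i + 1).
  · refine convergesFast_of_norm_le (K := (1 / α) ^ k * 2) (fun i => ?_)
    rw [norm_div, norm_pow, norm_pow, hz, one_pow, norm_natCast_add h0, ← one_div_pow]
    refine (pow_le_pow_left₀ (by positivity) (inv_add_le h0 h1 i) k).trans ?_
    rw [mul_pow, mul_assoc]
    refine mul_le_mul_of_nonneg_left ?_ (by positivity)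
    have hi : (0 : ℝ) ≤ i := Nat.cast_nonneg i
    calc (1 / ((i : ℝ) + 1)) ^ k ≤ (1 / ((i : ℝ) + 1)) ^ 2 :=
          pow_le_pow_of_le_one (by positivity)
            (by rw [div_le_one (by positivity)]; linarith) hk2
      _ ≤ _ := by
          rw [div_pow, one_pow, mul_one_div, div_le_div_iff₀ (by positivity) (by positivity)]
          nlinarith

theorem zetaPartial_eq_sum_range (n k : ℕ) (z : ℂ) :
    zetaPartial n k z = ∑ i ∈ Finset.range n, z ^ (i + 1) / ((i : ℂ) + ((1 : ℝ) : ℂ)) ^ k := by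
  unfold zetaPartial
  induction n with
  | zero => simp
  | succ n ih =>
    rw [Finset.sum_Icc_succ_top (by omega), ih, Finset.sum_range_succ]
    push_cast
    rfl

theorem tPartial_eq_sum_range (n k : ℕ) (z : ℂ) :
    tPartial n k z = ∑ i ∈ Finset.range n, z ^ (i + 1) / ((i : ℂ) + ((1 / 2 : ℝ) : ℂ)) ^ k := by
  unfold tPartial
  induction n with
  | zero => simp
  | succ n ih =>
    rw [Finset.sum_Icc_succ_top (by omega), ih, Finset.sum_range_succ]
    push_cast
    rw [show (n : ℂ) + 1 - 1 / 2 = n + 1 / 2 by ring]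

theorem convergesFast_zetaPartial {z : ℂ} (hz : ‖z‖ = 1) {k : ℕ} (hk : 1 ≤ k)
    (hkz : ((k, z) : ℕ × ℂ) ≠ (1, 1)) :
    ConvergesFast (fun n => zetaPartial n k z) (cycZeta k z) := by
  obtain ⟨l, hl⟩ := convergesFast_lerch hz hk hkz one_pos le_rfl
  simp only [← zetaPartial_eq_sum_range] at hl
  rwa [cycZeta, hl.tendsto.limUnder_eq]

theorem convergesFast_tPartial {z : ℂ} (hz : ‖z‖ = 1) {k : ℕ} (hk : 1 ≤ k)
    (hkz : ((k, z) : ℕ × ℂ) ≠ (1, 1)) :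
    ConvergesFast (fun n => tPartial n k z) (cycT k z) := by
  obtain ⟨l, hl⟩ := convergesFast_lerch hz hk hkz (α := 1 / 2) (by norm_num) (by norm_num)
  simp only [← tPartial_eq_sum_range] at hl
  rwa [cycT, hl.tendsto.limUnder_eq]

/-! ### Limits of bilinear sums. -/

/-- Splitting 1/(n(M-n+1)) into partial fractions bounds the sum by 2H_M/M, twice a Cesàro mean of
1/(i+1). -/
theorem tendsto_sum_inv_mul_inv_reflect :
    Tendsto (fun M : ℕ => ∑ n ∈ Finset.Icc 1 M, 1 / (n : ℝ) * (1 / (((M - n : ℕ) : ℝ) + 1)))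
      atTop (𝓝 0) := by
  have hc : Tendsto (fun M : ℕ => (M : ℝ)⁻¹ * ∑ i ∈ Finset.range M, 1 / ((i : ℝ) + 1))
      atTop (𝓝 0) := (tendsto_one_div_add_atTop_nhds_zero_nat (𝕜 := ℝ)).cesaro
  have hc2 := hc.const_mul 2
  rw [mul_zero] at hc2
  refine squeeze_zero (fun M => Finset.sum_nonneg fun n _ => by positivity) (fun M => ?_)
    hc2
  rcases M.eq_zero_or_pos with rfl | hM
  · simp
  have hM' : (0 : ℝ) < M := by exact_mod_cast hM
  have e1 : ∑ n ∈ Finset.Icc 1 M, 1 / (n : ℝ) = ∑ i ∈ Finset.range M, 1 / ((i : ℝ) + 1) := by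
    rw [Finset.range_eq_Ico, ← Finset.Ico_add_one_right_eq_Icc,
      ← Finset.sum_Ico_add' (fun n : ℕ => 1 / (n : ℝ)) 0 M 1]
    simp
  have e2 : ∑ n ∈ Finset.Icc 1 M, 1 / (((M - n : ℕ) : ℝ) + 1) =
      ∑ i ∈ Finset.range M, 1 / ((i : ℝ) + 1) := by
    rw [← Finset.sum_range_reflect, Finset.range_eq_Ico, ← Finset.Ico_add_one_right_eq_Icc,
      ← Finset.sum_Ico_add' (fun n : ℕ => 1 / (((M - n : ℕ) : ℝ) + 1)) 0 M 1]
    refine Finset.sum_congr rfl fun i _ => ?_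
    rw [show M - (i + 1) = M - 1 - i by omega]
  have e3 : ∀ n ∈ Finset.Icc 1 M, 1 / (n : ℝ) * (1 / (((M - n : ℕ) : ℝ) + 1)) ≤
      (M : ℝ)⁻¹ * (1 / (n : ℝ) + 1 / (((M - n : ℕ) : ℝ) + 1)) := by
    intro n hn
    rw [Finset.mem_Icc] at hn
    have h0 : (0 : ℝ) < n := by exact_mod_cast hn.1
    have h1 : (0 : ℝ) ≤ ((M - n : ℕ) : ℝ) := Nat.cast_nonneg _
    have h2 : (M : ℝ) = n + ((M - n : ℕ) : ℝ) := by rw [Nat.cast_sub hn.2]; ring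
    rw [h2]
    rw [div_add_div _ _ h0.ne' (by positivity), inv_mul_eq_div, div_mul_div_comm, div_div,
      div_le_div_iff₀ (by positivity) (by positivity)]
    have : 0 < (n : ℝ) * (((M - n : ℕ) : ℝ) + 1) := by positivity
    nlinarith
  refine (Finset.sum_le_sum e3).trans (le_of_eq ?_)
  rw [← Finset.mul_sum, Finset.sum_add_distrib, e1, e2]
  ring

/-- Each term tends to 0 and is dominated by 1/n², so the upper limit `L M` is irrelevant. -/
theorem tendsto_sum_inv_mul_inv_add (L : ℕ → ℕ) :
    Tendsto (fun M : ℕ => ∑ n ∈ Finset.Icc 1 (L M), 1 / (n : ℝ) * (1 / ((n : ℝ) + M)))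
      atTop (𝓝 0) := by
  have hs : Summable (fun n : ℕ => 1 / (n : ℝ) ^ 2) := by
    simp
  have hb : ∀ M n : ℕ, 1 / (n : ℝ) * (1 / ((n : ℝ) + M)) ≤ 1 / (n : ℝ) ^ 2 := by
    intro M n
    rcases n.eq_zero_or_pos with rfl | hn
    · simp
    have h0 : (0 : ℝ) < n := by exact_mod_cast hn
    rw [one_div_mul_one_div, pow_two]
    refine one_div_le_one_div_of_le (by positivity) ?_
    have : (0 : ℝ) ≤ M := Nat.cast_nonneg _
    nlinarith
  have ht : Tendsto (fun M : ℕ => ∑' n : ℕ, 1 / (n : ℝ) * (1 / ((n : ℝ) + M))) atTop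
      (𝓝 (∑' _ : ℕ, (0 : ℝ))) := by
    refine tendsto_tsum_of_dominated_convergence hs (fun n => ?_)
      (Eventually.of_forall fun M n => ?_)
    · have : Tendsto (fun M : ℕ => (n : ℝ) + M) atTop atTop :=
        tendsto_atTop_add_const_left _ _ tendsto_natCast_atTop_atTop
      simpa using (this.inv_tendsto_atTop).const_mul (1 / (n : ℝ))
    · rw [Real.norm_of_nonneg (by positivity)]
      exact hb M n
  rw [tsum_zero] at ht
  refine squeeze_zero (fun M => Finset.sum_nonneg fun n _ => by positivity) (fun M => ?_) ht
  exact Summable.sum_le_tsum _ (fun n _ => by positivity)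
    (hs.of_nonneg_of_le (fun n => by positivity) (hb M))

section Bilinear

variable {a t : ℕ → ℂ} {A T : ℂ}

/-- Write t n = T + (t n - T): the second part contributes an O(1/n²) series. -/
theorem exists_tendsto_sum_mul (ha : ∀ n, 1 ≤ n → ‖a n‖ ≤ 1 / (n : ℝ))
    (hA : Tendsto (fun N => ∑ n ∈ Finset.Icc 1 N, a n) atTop (𝓝 A)) (ht : ConvergesFast t T) :
    ∃ U, Tendsto (fun N => ∑ n ∈ Finset.Icc 1 N, a n * t n) atTop (𝓝 U) := by
  obtain ⟨C, hC0, hC⟩ := ht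
  obtain ⟨l, hl⟩ := convergesFast_of_norm_le (u := fun i => a (i + 1) * (t (i + 1) - T)) (K := C)
    fun i => by
      rw [norm_mul]
      refine (mul_le_mul (ha (i + 1) (by omega)) (hC (i + 1)) (norm_nonneg _)
        (by positivity)).trans (le_of_eq ?_)
      push_cast
      rw [show (i : ℝ) + 1 + 1 = i + 2 by ring]
      field_simp
  refine ⟨A * T + l, ((hA.mul_const T).add hl.tendsto).congr fun N => ?_⟩
  rw [Finset.range_eq_Ico, Finset.sum_Ico_add' (fun n : ℕ => a n * (t n - T)) 0 N 1,
    Finset.Ico_add_one_right_eq_Icc, zero_add, Finset.sum_mul, ← Finset.sum_add_distrib]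
  exact Finset.sum_congr rfl fun n _ => by ring

theorem tendsto_sum_mul_of_error {s : ℕ → Finset ℕ} {r : ℕ → ℕ → ℕ} {C : ℝ} {e : ℕ → ℝ}
    (hC : ∀ n, ‖t n - T‖ ≤ C * (1 / ((n : ℝ) + 1)))
    (hA : Tendsto (fun N => ∑ n ∈ s N, a n) atTop (𝓝 A))
    (he : Tendsto e atTop (𝓝 0))
    (hb : ∀ N, ∑ n ∈ s N, ‖a n‖ * (1 / ((r N n : ℝ) + 1)) ≤ e N) (hC0 : 0 ≤ C) :
    Tendsto (fun N => ∑ n ∈ s N, a n * t (r N n)) atTop (𝓝 (A * T)) := by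
  have h0 : Tendsto (fun N => ∑ n ∈ s N, a n * (t (r N n) - T)) atTop (𝓝 0) := by
    refine squeeze_zero_norm (fun N => ?_) (by simpa using he.const_mul C)
    refine (norm_sum_le _ _).trans (le_trans ?_ (mul_le_mul_of_nonneg_left (hb N) hC0))
    rw [Finset.mul_sum]
    refine Finset.sum_le_sum fun n _ => ?_
    rw [norm_mul, mul_left_comm]
    exact mul_le_mul_of_nonneg_left (hC _) (norm_nonneg _)
  have := (hA.mul_const T).add h0
  rw [add_zero] at this
  refine this.congr fun N => ?_
  rw [Finset.sum_mul, ← Finset.sum_add_distrib]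
  exact Finset.sum_congr rfl fun n _ => by ring

theorem tendsto_sum_mul_reflect (ha : ∀ n, 1 ≤ n → ‖a n‖ ≤ 1 / (n : ℝ))
    (hA : Tendsto (fun N => ∑ n ∈ Finset.Icc 1 N, a n) atTop (𝓝 A)) (ht : ConvergesFast t T)
    (t0 : t 0 = 0) {L : ℕ → ℕ} (hL : ∀ M, M ≤ L M) :
    Tendsto (fun M => ∑ n ∈ Finset.Icc 1 (L M), a n * t (M - n)) atTop (𝓝 (A * T)) := by
  obtain ⟨C, hC0, hC⟩ := ht
  refine (tendsto_sum_mul_of_error (s := fun M => Finset.Icc 1 M) (r := fun M n => M - n) hC hA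
    tendsto_sum_inv_mul_inv_reflect (fun M => ?_) hC0).congr fun M => ?_
  · refine Finset.sum_le_sum fun n hn => ?_
    exact mul_le_mul_of_nonneg_right (ha n (Finset.mem_Icc.mp hn).1) (by positivity)
  -- Truncated subtraction and `t0` kill the terms with n > M.
  · refine Finset.sum_subset (Finset.Icc_subset_Icc_right (hL M)) fun n hn hn' => ?_
    rw [Finset.mem_Icc] at hn hn'
    rw [show M - n = 0 by omega, t0, mul_zero]

theorem tendsto_sum_mul_add (ha : ∀ n, 1 ≤ n → ‖a n‖ ≤ 1 / (n : ℝ))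
    (hA : Tendsto (fun N => ∑ n ∈ Finset.Icc 1 N, a n) atTop (𝓝 A)) (ht : ConvergesFast t T)
    {L : ℕ → ℕ} (hL : ∀ M, M ≤ L M) :
    Tendsto (fun M => ∑ n ∈ Finset.Icc 1 (L M), a n * t (n + M)) atTop (𝓝 (A * T)) := by
  obtain ⟨C, hC0, hC⟩ := ht
  refine tendsto_sum_mul_of_error (s := fun M => Finset.Icc 1 (L M)) (r := fun M n => n + M) hC
    (hA.comp (tendsto_atTop_mono hL tendsto_id))
    (tendsto_sum_inv_mul_inv_add L) (fun M => ?_) hC0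
  refine Finset.sum_le_sum fun n hn => ?_
  have h1 := (Finset.mem_Icc.mp hn).1
  have h0 : (0 : ℝ) < n := by exact_mod_cast h1
  refine mul_le_mul (ha n h1) (one_div_le_one_div_of_le (by positivity) ?_) (by positivity)
    (by positivity)
  push_cast
  linarith

/-- Only n > M contributes, and the sum of a n over M < n ≤ L M is a Cauchy tail. After n ↦ n + M
the error sum is again of the form 1/(n(n+M)). -/
theorem tendsto_sum_mul_sub (ha : ∀ n, 1 ≤ n → ‖a n‖ ≤ 1 / (n : ℝ))
    (hA : Tendsto (fun N => ∑ n ∈ Finset.Icc 1 N, a n) atTop (𝓝 A)) (ht : ConvergesFast t T)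
    (t0 : t 0 = 0) {L : ℕ → ℕ} (hL : ∀ M, M ≤ L M) :
    Tendsto (fun M => ∑ n ∈ Finset.Icc 1 (L M), a n * t (n - M)) atTop (𝓝 0) := by
  obtain ⟨C, hC0, hC⟩ := ht
  have hsub : ∀ (f : ℕ → ℂ) (M : ℕ), ∑ n ∈ Finset.Icc 1 (L M), f n =
      ∑ n ∈ Finset.Icc 1 M, f n + ∑ n ∈ Finset.Ioc M (L M), f n := by
    intro f M
    rw [← Finset.sum_union]
    · congr 1
      ext n
      have := hL M
      simp only [Finset.mem_union, Finset.mem_Icc, Finset.mem_Ioc]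
      omega
    · rw [Finset.disjoint_left]
      intro n
      simp only [Finset.mem_Icc, Finset.mem_Ioc]
      omega
  have hA0 : Tendsto (fun M => ∑ n ∈ Finset.Ioc M (L M), a n) atTop (𝓝 0) := by
    have := (hA.comp (tendsto_atTop_mono hL tendsto_id)).sub hA
    rw [sub_self] at this
    refine this.congr fun M => ?_
    simp only [Function.comp]
    rw [hsub]
    ring
  have := tendsto_sum_mul_of_error (s := fun M => Finset.Ioc M (L M)) (r := fun M n => n - M) hC
    hA0 (tendsto_sum_inv_mul_inv_add fun M => L M - M) (fun M => ?_) hC0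
  · rw [zero_mul] at this
    refine this.congr fun M => ?_
    rw [hsub, Finset.sum_eq_zero (s := Finset.Icc 1 M), zero_add]
    intro n hn
    rw [Finset.mem_Icc] at hn
    rw [show n - M = 0 by omega, t0, mul_zero]
  · have e : Finset.Ioc M (L M) = (Finset.Icc 1 (L M - M)).image (· + M) := by
      have := hL M
      rw [Finset.image_add_right_Icc]
      ext n
      simp only [Finset.mem_Icc, Finset.mem_Ioc]
      omega
    rw [e, Finset.sum_image (by simp)]
    refine Finset.sum_le_sum fun n hn => ?_
    have h1 := (Finset.mem_Icc.mp hn).1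
    have h0 : (0 : ℝ) < n := by exact_mod_cast h1
    rw [Nat.add_sub_cancel, mul_comm]
    refine mul_le_mul (one_div_le_one_div_of_le h0 (by linarith)) ?_ (norm_nonneg _)
      (by positivity)
    simpa using ha (n + M) (by omega)

end Bilinear

/-! ### Rational span of products, graded by weight. -/

section Span

variable {x y : ℂ}

theorem IsSingleValueProduct.mul {w w' : ℕ} {v v' : ℂ} (h : IsSingleValueProduct x y w v)
    (h' : IsSingleValueProduct x y w' v') : IsSingleValueProduct x y (w + w') (v * v') := by
  induction h with
  | one => simpa using h'
  | zeta_mul k a b hk hka _ ih => rw [add_assoc, mul_assoc]; exact .zeta_mul k a b hk hka ih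
  | t_mul k a b hk hka _ ih => rw [add_assoc, mul_assoc]; exact .t_mul k a b hk hka ih

theorem mul_mem_span_productTerms (hx : x ≠ 0) (hy : y ≠ 0) {w w' : ℕ} {u u' : ℂ}
    (h : u ∈ Submodule.span ℚ (productTerms x y w))
    (h' : u' ∈ Submodule.span ℚ (productTerms x y w')) :
    u * u' ∈ Submodule.span ℚ (productTerms x y (w + w')) := by
  have hm := Submodule.mul_mem_mul h h'
  rw [Submodule.span_mul_span] at hm
  refine Submodule.span_mono ?_ hm
  rintro _ ⟨_, ⟨a, b, v, hv, rfl⟩, _, ⟨a', b', v', hv', rfl⟩, rfl⟩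
  refine ⟨a + a', b + b', v * v', hv.mul hv', ?_⟩
  simp only [zpow_add₀ hx, zpow_add₀ hy]
  ring

theorem monomial_mem_span_productTerms (a b : ℤ) :
    x ^ a * y ^ b ∈ Submodule.span ℚ (productTerms x y 0) :=
  Submodule.subset_span ⟨a, b, 1, .one, by ring⟩

theorem cycZeta_mem_span_productTerms {k : ℕ} (hk : 1 ≤ k) (a b : ℤ)
    (h : ((k, x ^ a * y ^ b) : ℕ × ℂ) ≠ (1, 1)) :
    cycZeta k (x ^ a * y ^ b) ∈ Submodule.span ℚ (productTerms x y k) :=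
  Submodule.subset_span ⟨0, 0, _, .zeta_mul k a b hk h .one, by simp⟩

theorem cycT_mem_span_productTerms {k : ℕ} (hk : 1 ≤ k) (a b : ℤ)
    (h : ((k, x ^ a * y ^ b) : ℕ × ℂ) ≠ (1, 1)) :
    cycT k (x ^ a * y ^ b) ∈ Submodule.span ℚ (productTerms x y k) :=
  Submodule.subset_span ⟨0, 0, _, .t_mul k a b hk h .one, by simp⟩

theorem ratCast_mul_mem_span {S : Set ℂ} {u : ℂ} (c : ℚ) (h : u ∈ Submodule.span ℚ S) :
    (c : ℂ) * u ∈ Submodule.span ℚ S := by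
  rw [← Rat.smul_def]
  exact Submodule.smul_mem _ c h

theorem neg_one_pow_mul_mem_span {S : Set ℂ} {u : ℂ} (k : ℕ) (h : u ∈ Submodule.span ℚ S) :
    (-1 : ℂ) ^ k * u ∈ Submodule.span ℚ S := by
  simpa using ratCast_mul_mem_span ((-1) ^ k) h

end Span

/-! ### Partial fractions. -/

/-- Partial fraction decomposition of `1 / (u ^ p * v ^ q)` with respect to `u + v`. -/
theorem exists_partial_fractions (p q : ℕ) (h : 1 ≤ p + q) :
    ∃ c d : ℕ → ℚ, ∀ u v : ℂ, u ≠ 0 → v ≠ 0 → u + v ≠ 0 →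
      1 / (u ^ p * v ^ q) =
        ∑ i ∈ Finset.Icc 1 p, (c i : ℂ) / ((u + v) ^ (p + q - i) * u ^ i) +
        ∑ j ∈ Finset.Icc 1 q, (d j : ℂ) / ((u + v) ^ (p + q - j) * v ^ j) := by
  -- Multiplication by 1/N raises the weight by one; `c` is extended by zero to i = p + 1 so that
  -- both families share an index set.
  have key : ∀ (c c' : ℕ → ℚ) (p w : ℕ), p + 1 ≤ w → ∀ N u : ℂ, N ≠ 0 →
      ∑ i ∈ Finset.Icc 1 (p + 1), (((if i ≤ p then c i else 0) + c' i : ℚ) : ℂ) /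
        (N ^ (w + 1 - i) * u ^ i) =
      1 / N * (∑ i ∈ Finset.Icc 1 p, (c i : ℂ) / (N ^ (w - i) * u ^ i) +
        ∑ i ∈ Finset.Icc 1 (p + 1), (c' i : ℂ) / (N ^ (w - i) * u ^ i)) := by
    intro c c' p w hw N u hN
    have e : ∑ i ∈ Finset.Icc 1 p, (c i : ℂ) / (N ^ (w - i) * u ^ i) =
        ∑ i ∈ Finset.Icc 1 (p + 1), ((if i ≤ p then c i else 0 : ℚ) : ℂ) /
          (N ^ (w - i) * u ^ i) := by
      rw [Finset.sum_Icc_succ_top (by omega)]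
      simp only [add_le_iff_nonpos_right, nonpos_iff_eq_zero, one_ne_zero, if_false, Rat.cast_zero,
        zero_div, add_zero]
      exact Finset.sum_congr rfl fun i hi => by rw [if_pos (Finset.mem_Icc.mp hi).2]
    rw [e, ← Finset.sum_add_distrib, Finset.mul_sum]
    refine Finset.sum_congr rfl fun i hi => ?_
    rw [Finset.mem_Icc] at hi
    rw [show w + 1 - i = w - i + 1 by omega, ← add_div, div_mul_div_comm, one_mul, pow_succ']
    push_cast
    rw [mul_assoc]
  induction hn : p + q generalizing p q with
  | zero => omega
  | succ n ih =>
    rcases p with _ | p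
    · refine ⟨0, fun j => if j = q then 1 else 0, fun u v hu hv hN => ?_⟩
      have hq : n + 1 = q := by omega
      have hm : q ∈ Finset.Icc 1 q := Finset.mem_Icc.mpr ⟨by omega, le_rfl⟩
      rw [Finset.sum_eq_single_of_mem q hm fun j _ hj => by simp [hj]]
      simp [hq]
    rcases q with _ | q
    · refine ⟨fun j => if j = p + 1 then 1 else 0, 0, fun u v hu hv hN => ?_⟩
      have hq : n = p := by omega
      have hm : p + 1 ∈ Finset.Icc 1 (p + 1) := Finset.mem_Icc.mpr ⟨by omega, le_rfl⟩
      rw [Finset.sum_eq_single_of_mem (p + 1) hm fun j _ hj => by simp [hj]]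
      simp [hq]
    obtain ⟨c₁, d₁, h₁⟩ := ih p (q + 1) (by omega) (by omega)
    obtain ⟨c₂, d₂, h₂⟩ := ih (p + 1) q (by omega) (by omega)
    refine ⟨fun i => (if i ≤ p then c₁ i else 0) + c₂ i,
      fun j => (if j ≤ q then d₂ j else 0) + d₁ j, fun u v hu hv hN => ?_⟩
    have hn' : n = p + q + 1 := by omega
    rw [key c₁ c₂ p n (by omega) _ _ hN, key d₂ d₁ q n (by omega) _ _ hN]
    -- The recursion comes from 1/(uv) = (1/(u+v))(1/u + 1/v).
    have e : 1 / (u ^ (p + 1) * v ^ (q + 1)) =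
        1 / (u + v) * (1 / (u ^ p * v ^ (q + 1)) + 1 / (u ^ (p + 1) * v ^ q)) := by
      field_simp
      ring
    rw [e, h₁ u v hu hv hN, h₂ u v hu hv hN]
    ring

/-! ### Two-sided series. -/

/-- The general term `w ^ m / (m - 1 / 2) ^ k` of the two-sided `t`-series. -/
noncomputable def tTerm (k : ℕ) (w : ℂ) (m : ℤ) : ℂ := w ^ m / ((m : ℂ) - 1 / 2) ^ k

theorem intCast_sub_half_ne_zero (m : ℤ) : (m : ℂ) - 1 / 2 ≠ 0 := by
  intro h
  have h2 : ((2 * m - 1 : ℤ) : ℂ) = 0 := by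
    push_cast
    linear_combination 2 * h
  have : 2 * m - 1 = 0 := by exact_mod_cast h2
  omega

/-- The reflection m ↦ 1 - m changes the sign of m - 1/2; this is the origin of the sign and of the
factor y in the parity relation. -/
theorem tTerm_one_sub {w : ℂ} (hw : w ≠ 0) (k : ℕ) (m : ℤ) :
    tTerm k w (1 - m) = (-1) ^ k * w * tTerm k w⁻¹ m := by
  have h := intCast_sub_half_ne_zero m
  unfold tTerm
  have e : (((1 - m : ℤ) : ℂ) - 1 / 2) = -1 * ((m : ℂ) - 1 / 2) := by push_cast; ring
  rw [e, mul_pow, zpow_sub₀ hw, zpow_one, inv_zpow]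
  have h1 : ((-1 : ℂ) ^ k) * (-1) ^ k = 1 := by rw [← mul_pow]; simp
  have h2 : (-1 : ℂ) ^ k ≠ 0 := by simp
  generalize (m : ℂ) - 1 / 2 = d at h
  generalize (-1 : ℂ) ^ k = s at h1 h2 ⊢
  field_simp
  linear_combination -h1

theorem tPartial_succ (n k : ℕ) (w : ℂ) :
    tPartial (n + 1) k w = tPartial n k w + tTerm k w ((n : ℤ) + 1) := by
  unfold tPartial tTerm
  rw [Finset.sum_Icc_succ_top (by omega)]
  push_cast
  congr 2

/-- Partial sums of the two-sided `t`-series over blocks of consecutive integers. -/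
theorem sum_tTerm_block {w : ℂ} (hw : w ≠ 0) (k n M : ℕ) :
    ∑ i ∈ Finset.Icc 1 M, tTerm k w ((i : ℤ) - n) =
      (-1) ^ k * w * (tPartial n k w⁻¹ - tPartial (n - M) k w⁻¹) + tPartial (M - n) k w := by
  induction M with
  | zero => simp [tPartial]
  | succ M ih =>
    rw [Finset.sum_Icc_succ_top (by omega), ih]
    rcases le_or_gt n M with h | h
    · rw [show n - M = 0 by omega, show n - (M + 1) = 0 by omega,
        show M + 1 - n = M - n + 1 by omega, tPartial_succ]
      push_cast [Nat.cast_sub h]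
      rw [show (M : ℤ) + 1 - n = M - n + 1 by ring]
      ring
    · obtain ⟨r, rfl⟩ := Nat.exists_eq_add_of_lt h
      rw [show M + r + 1 - M = r + 1 by omega, show M + r + 1 - (M + 1) = r by omega,
        show M - (M + r + 1) = 0 by omega, show M + 1 - (M + r + 1) = 0 by omega, tPartial_succ r]
      push_cast
      rw [show (M : ℤ) + 1 - (M + r + 1) = 1 - (r + 1) by ring, tTerm_one_sub hw]
      ring

theorem sum_tTerm_shift (k : ℕ) (w : ℂ) (n M : ℕ) :
    ∑ i ∈ Finset.Icc 1 M, tTerm k w ((i : ℤ) + n) = tPartial (n + M) k w - tPartial n k w := by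
  induction M with
  | zero => simp
  | succ M ih =>
    rw [Finset.sum_Icc_succ_top (by omega), ih, ← add_assoc, tPartial_succ]
    push_cast
    rw [show (M : ℤ) + 1 + n = n + M + 1 by ring]
    ring

theorem tendsto_tTerm {w : ℂ} (hw : ‖w‖ = 1) {k : ℕ} (hk : 1 ≤ k) (c : ℤ) :
    Tendsto (fun n : ℕ => tTerm k w (c + n)) atTop (𝓝 0) := by
  have h1 : Tendsto (fun n : ℕ => ‖((c : ℂ) - 1 / 2) + n‖) atTop atTop := by
    have : Tendsto (fun n : ℕ => (n : ℝ) - ‖(c : ℂ) - 1 / 2‖) atTop atTop :=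
      tendsto_atTop_add_const_right _ _ tendsto_natCast_atTop_atTop
    refine tendsto_atTop_mono (fun n => ?_) this
    have := norm_sub_norm_le (n : ℂ) (-((c : ℂ) - 1 / 2))
    rw [norm_neg, Complex.norm_natCast, sub_neg_eq_add, add_comm (n : ℂ)] at this
    exact this
  have h2 := ((tendsto_pow_atTop (by omega : k ≠ 0)).comp h1).inv_tendsto_atTop
  rw [tendsto_zero_iff_norm_tendsto_zero]
  refine h2.congr fun n => ?_
  unfold tTerm
  simp only [Function.comp, Pi.inv_apply, norm_div, norm_zpow, norm_pow, hw, one_zpow, one_div]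
  push_cast
  congr 3
  ring

theorem pair_ne_of_inv {k : ℕ} {z : ℂ} (h : ((k, z) : ℕ × ℂ) ≠ (1, 1)) :
    ((k, z⁻¹) : ℕ × ℂ) ≠ (1, 1) := by
  simpa [Prod.ext_iff] using h

/-- The symmetric partial sums of `∑ w ^ (-n) / n ^ k` over nonzero integers `n`. -/
theorem exists_tendsto_two_sided_zeta {x y w : ℂ} (hw : w = x * y) (hw1 : ‖w‖ = 1) {k : ℕ}
    (hk : 1 ≤ k) :
    ∃ B ∈ Submodule.span ℚ (productTerms x y k),
      Tendsto (fun L : ℕ => zetaPartial L k w⁻¹ + (-1) ^ k * zetaPartial L k w) atTop (𝓝 B) := by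
  -- Here Li_1(1) would diverge, but the two harmonic sums cancel exactly.
  by_cases h : ((k, w) : ℕ × ℂ) = (1, 1)
  · obtain ⟨rfl, rfl⟩ := Prod.ext_iff.mp h
    exact ⟨0, Submodule.zero_mem _, by simp⟩
  · have e : w = x ^ (1 : ℤ) * y ^ (1 : ℤ) := by simp [hw]
    have e' : w⁻¹ = x ^ (-1 : ℤ) * y ^ (-1 : ℤ) := by simp [hw, mul_comm]
    have h' := pair_ne_of_inv h
    refine ⟨cycZeta k w⁻¹ + (-1) ^ k * cycZeta k w, Submodule.add_mem _ ?_
      (neg_one_pow_mul_mem_span _ ?_), ?_⟩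
    · rw [e'] at h' ⊢
      exact cycZeta_mem_span_productTerms hk _ _ h'
    · rw [e] at h ⊢
      exact cycZeta_mem_span_productTerms hk _ _ h
    · exact (convergesFast_zetaPartial (by simp [hw1]) hk h').tendsto.add
        ((convergesFast_zetaPartial hw1 hk h).tendsto.const_mul _)

/-- Moving the centre of the window from k to k + 1 gains the index k + 1 + L and loses k - L. -/
theorem sum_tTerm_symm_succ (j k L : ℕ) (w : ℂ) :
    ∑ n ∈ Finset.Icc 1 L, (tTerm j w ((k + 1 : ℕ) - n) + tTerm j w ((k + 1 : ℕ) + n)) +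
        tTerm j w (k + 1 : ℕ) =
      ∑ n ∈ Finset.Icc 1 L, (tTerm j w ((k : ℤ) - n) + tTerm j w ((k : ℤ) + n)) + tTerm j w k +
        tTerm j w ((k : ℤ) + 1 + L) - tTerm j w ((k : ℤ) - L) := by
  induction L with
  | zero => simp
  | succ L ih =>
    rw [Finset.sum_Icc_succ_top (by omega), Finset.sum_Icc_succ_top (by omega)]
    push_cast at ih ⊢
    rw [show (k : ℤ) + 1 - (L + 1) = k - L by ring, show (k : ℤ) + (L + 1) = k + 1 + L by ring]
    linear_combination ih

/-- The partial sums of the two-sided `t`-series, symmetric about any natural number. -/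
theorem exists_tendsto_two_sided_t {x y w : ℂ} (hx : x ≠ 0) (hy : y ≠ 0) (hw : w = x * y)
    (hw1 : ‖w‖ = 1) {j : ℕ} (hj : 1 ≤ j) :
    ∃ B ∈ Submodule.span ℚ (productTerms x y j), ∀ k : ℕ,
      Tendsto (fun L : ℕ => ∑ n ∈ Finset.Icc 1 L, (tTerm j w ((k : ℤ) - n) +
        tTerm j w ((k : ℤ) + n)) + tTerm j w k) atTop (𝓝 B) := by
  have hw0 : w ≠ 0 := by rw [hw]; exact mul_ne_zero hx hy
  -- For centre 0, reflection sends the indices -L, …, 0 to L + 1, …, 1, hence the cutoff L + 1.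
  -- Other centres differ by boundary terms that vanish.
  suffices h : ∃ B ∈ Submodule.span ℚ (productTerms x y j),
      Tendsto (fun L : ℕ => (-1) ^ j * w * tPartial (L + 1) j w⁻¹ + tPartial L j w)
        atTop (𝓝 B) by
    obtain ⟨B, hB, hlim⟩ := h
    refine ⟨B, hB, fun k => ?_⟩
    induction k with
    | zero =>
      refine hlim.congr fun L => ?_
      induction L with
      | zero =>
        have := tTerm_one_sub hw0 j 1
        simp only [sub_self] at this
        rw [tPartial_succ]
        simp [this, tPartial]
      | succ L ih =>
        rw [Finset.sum_Icc_succ_top (by omega), tPartial_succ (L + 1), tPartial_succ L j w]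
        have := tTerm_one_sub hw0 j (L + 2)
        rw [show (1 : ℤ) - (L + 2) = -(L + 1) by ring] at this
        push_cast at ih ⊢
        rw [zero_sub, zero_add, this, show (L : ℤ) + 1 + 1 = L + 2 by ring]
        linear_combination ih
    | succ k ih =>
      have h1 := tendsto_tTerm hw1 hj ((k : ℤ) + 1)
      have h2 := (tendsto_tTerm (w := w⁻¹) (by simp [hw1]) hj (1 - (k : ℤ))).const_mul
        ((-1) ^ j * w)
      have h3 := (ih.add h1).sub h2
      rw [mul_zero, add_zero, sub_zero] at h3
      refine h3.congr fun L => ?_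
      rw [sum_tTerm_symm_succ, ← tTerm_one_sub hw0]
      ring_nf
  -- The divergent parts cancel up to minus the term of index L + 1, which tends to 0.
  by_cases h : ((j, w) : ℕ × ℂ) = (1, 1)
  · obtain ⟨rfl, rfl⟩ := Prod.ext_iff.mp h
    refine ⟨0, Submodule.zero_mem _, ?_⟩
    have := (tendsto_tTerm hw1 hj 1).neg
    rw [neg_zero] at this
    refine this.congr fun L => ?_
    simp only [inv_one]
    rw [tPartial_succ, add_comm (L : ℤ) 1]
    ring
  · have e : w = x ^ (1 : ℤ) * y ^ (1 : ℤ) := by simp [hw]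
    have e' : w⁻¹ = x ^ (-1 : ℤ) * y ^ (-1 : ℤ) := by simp [hw, mul_comm]
    have h' := pair_ne_of_inv h
    refine ⟨(-1) ^ j * w * cycT j w⁻¹ + cycT j w, Submodule.add_mem _ ?_ ?_, ?_⟩
    · rw [mul_assoc]
      refine neg_one_pow_mul_mem_span _ ?_
      rw [← zero_add j]
      refine mul_mem_span_productTerms hx hy ?_ ?_
      · rw [e]
        exact monomial_mem_span_productTerms 1 1
      · rw [zero_add, e'] at *
        exact cycT_mem_span_productTerms hj _ _ h'
    · rw [e] at h ⊢
      exact cycT_mem_span_productTerms hj _ _ h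
    · exact (((convergesFast_tPartial (by simp [hw1]) hj h').tendsto.comp
        (tendsto_add_atTop_nat 1)).const_mul _).add (convergesFast_tPartial hw1 hj h).tendsto

/-! ### The strip sum by rows. -/

/-- The sum of `x ^ (-n) y ^ (k - n) / (n ^ p (k - n - 1 / 2) ^ q)` over the nonzero integers
`n ∈ [-L, L]` and `k ∈ [1, M]`. -/
noncomputable def stripSum (L M p q : ℕ) (x y : ℂ) : ℂ :=
  ∑ k ∈ Finset.Icc 1 M, ∑ n ∈ Finset.Icc 1 L,
    (x⁻¹ ^ n / (n : ℂ) ^ p * tTerm q y ((k : ℤ) - n) +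
      (-1) ^ p * (x ^ n / (n : ℂ) ^ p) * tTerm q y ((k : ℤ) + n))

/-- Take u = n and v = k - n - 1/2, and regroup x^(-n) y^(k-n) as y^k (xy)^(-n) or as x^(-k)
(xy)^(k-n). -/
theorem strip_term_eq {x y : ℂ} (hx : x ≠ 0) (hy : y ≠ 0) {p q : ℕ} {c d : ℕ → ℚ}
    (hcd : ∀ u v : ℂ, u ≠ 0 → v ≠ 0 → u + v ≠ 0 →
      1 / (u ^ p * v ^ q) =
        ∑ i ∈ Finset.Icc 1 p, (c i : ℂ) / ((u + v) ^ (p + q - i) * u ^ i) +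
        ∑ j ∈ Finset.Icc 1 q, (d j : ℂ) / ((u + v) ^ (p + q - j) * v ^ j))
    (k n : ℤ) (hn : n ≠ 0) :
    x ^ (-n) / (n : ℂ) ^ p * tTerm q y (k - n) =
      ∑ i ∈ Finset.Icc 1 p, (c i : ℂ) * tTerm (p + q - i) y k * ((x * y) ^ (-n) / (n : ℂ) ^ i) +
      ∑ j ∈ Finset.Icc 1 q, (d j : ℂ) * tTerm (p + q - j) x⁻¹ k * tTerm j (x * y) (k - n) := by
  have h := hcd (n : ℂ) (((k - n : ℤ) : ℂ) - 1 / 2) (by exact_mod_cast hn)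
    (intCast_sub_half_ne_zero _)
  have e : (n : ℂ) + (((k - n : ℤ) : ℂ) - 1 / 2) = (k : ℂ) - 1 / 2 := by push_cast; ring
  rw [e] at h
  have h := h (intCast_sub_half_ne_zero k)
  unfold tTerm
  rw [div_mul_div_comm, ← mul_one_div, h, mul_add, Finset.mul_sum, Finset.mul_sum]
  have e1 : x ^ (-n) * y ^ (k - n) = y ^ k * (x * y) ^ (-n) := by
    rw [mul_zpow, sub_eq_add_neg, zpow_add₀ hy]; ring
  have e2 : x ^ (-n) * y ^ (k - n) = x⁻¹ ^ k * (x * y) ^ (k - n) := by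
    rw [mul_zpow, sub_eq_add_neg, zpow_add₀ hx, inv_zpow, ← mul_assoc, ← mul_assoc,
      inv_mul_cancel₀ (zpow_ne_zero _ hx), one_mul]
  congr 1
  · refine Finset.sum_congr rfl fun i _ => ?_
    rw [e1]
    simp only [div_eq_mul_inv, mul_inv]
    ring
  · refine Finset.sum_congr rfl fun i _ => ?_
    rw [e2]
    simp only [div_eq_mul_inv, mul_inv]
    ring

theorem tPartial_eq_sum_tTerm (M k : ℕ) (w : ℂ) :
    tPartial M k w = ∑ i ∈ Finset.Icc 1 M, tTerm k w i := by
  unfold tPartial tTerm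
  simp

/-- The indices n and -n are paired. The missing n = 0 term is added and subtracted to complete the
symmetric window. -/
theorem stripSum_eq {x y : ℂ} (hx : x ≠ 0) (hy : y ≠ 0) {p q : ℕ} {c d : ℕ → ℚ}
    (hcd : ∀ u v : ℂ, u ≠ 0 → v ≠ 0 → u + v ≠ 0 →
      1 / (u ^ p * v ^ q) =
        ∑ i ∈ Finset.Icc 1 p, (c i : ℂ) / ((u + v) ^ (p + q - i) * u ^ i) +
        ∑ j ∈ Finset.Icc 1 q, (d j : ℂ) / ((u + v) ^ (p + q - j) * v ^ j)) (L M : ℕ) :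
    stripSum L M p q x y = ∑ k ∈ Finset.Icc 1 M,
      (∑ i ∈ Finset.Icc 1 p, (c i : ℂ) * tTerm (p + q - i) y k *
        (zetaPartial L i (x * y)⁻¹ + (-1) ^ i * zetaPartial L i (x * y)) +
      ∑ j ∈ Finset.Icc 1 q, (d j : ℂ) * tTerm (p + q - j) x⁻¹ k *
        (∑ n ∈ Finset.Icc 1 L, (tTerm j (x * y) ((k : ℤ) - n) + tTerm j (x * y) ((k : ℤ) + n)) +
          tTerm j (x * y) k - tTerm j (x * y) k)) := by
  refine Finset.sum_congr rfl fun k _ => ?_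
  have hneg : ∀ (i : ℕ) (z a : ℂ), a / (-z) ^ i = (-1) ^ i * (a / z ^ i) := by
    intro i z a
    rw [neg_pow, ← div_div, div_right_comm, mul_comm, ← one_div_mul_eq_div]
    rcases neg_one_pow_eq_or ℂ i with h | h <;> simp [h, mul_comm]
  have key : ∀ n ∈ Finset.Icc 1 L, x⁻¹ ^ n / (n : ℂ) ^ p * tTerm q y ((k : ℤ) - n) +
      (-1) ^ p * (x ^ n / (n : ℂ) ^ p) * tTerm q y ((k : ℤ) + n) =
      ∑ i ∈ Finset.Icc 1 p, (c i : ℂ) * tTerm (p + q - i) y k *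
        ((x * y)⁻¹ ^ n / (n : ℂ) ^ i + (-1) ^ i * ((x * y) ^ n / (n : ℂ) ^ i)) +
      ∑ j ∈ Finset.Icc 1 q, (d j : ℂ) * tTerm (p + q - j) x⁻¹ k *
        (tTerm j (x * y) ((k : ℤ) - n) + tTerm j (x * y) ((k : ℤ) + n)) := by
    intro n hn
    have hn0 : n ≠ 0 := by have := (Finset.mem_Icc.mp hn).1; omega
    have h1 := strip_term_eq hx hy hcd k n (by exact_mod_cast hn0)
    have h2 := strip_term_eq hx hy hcd k (-n) (by simpa using hn0)
    simp only [neg_neg, zpow_neg, zpow_natCast, Int.cast_neg, Int.cast_natCast, sub_neg_eq_add,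
      hneg, ← inv_pow] at h1 h2
    rw [h1, h2]
    simp only [mul_add, Finset.sum_add_distrib]
    ring
  rw [Finset.sum_congr rfl key, Finset.sum_add_distrib, Finset.sum_comm,
    Finset.sum_comm (s := Finset.Icc 1 L)]
  simp only [add_sub_cancel_right, zetaPartial, ← Finset.mul_sum, Finset.sum_add_distrib]

/-- The strip sums tend to a rational combination of products of single values. -/
theorem exists_tendsto_stripSum {x y : ℂ} (hx : ‖x‖ = 1) (hy : ‖y‖ = 1) {p q : ℕ} (hp : 1 ≤ p)
    (hq : 1 ≤ q) (hpx : ((p, x) : ℕ × ℂ) ≠ (1, 1)) (hqy : ((q, y) : ℕ × ℂ) ≠ (1, 1)) :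
    ∃ Q ∈ Submodule.span ℚ (productTerms x y (p + q)), ∃ F : ℕ → ℂ,
      (∀ M, Tendsto (fun L => stripSum L M p q x y) atTop (𝓝 (F M))) ∧
      Tendsto F atTop (𝓝 Q) := by
  have hx0 : x ≠ 0 := norm_pos_iff.mp (by rw [hx]; exact one_pos)
  have hy0 : y ≠ 0 := norm_pos_iff.mp (by rw [hy]; exact one_pos)
  have hw1 : ‖x * y‖ = 1 := by simp [hx, hy]
  obtain ⟨c, d, hcd⟩ := exists_partial_fractions p q (by omega)
  have hB : ∀ i, ∃ B, 1 ≤ i → B ∈ Submodule.span ℚ (productTerms x y i) ∧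
      Tendsto (fun L : ℕ => zetaPartial L i (x * y)⁻¹ + (-1) ^ i * zetaPartial L i (x * y))
        atTop (𝓝 B) := fun i => by
    by_cases hi : 1 ≤ i
    · obtain ⟨B, h1, h2⟩ := exists_tendsto_two_sided_zeta rfl hw1 hi
      exact ⟨B, fun _ => ⟨h1, h2⟩⟩
    · exact ⟨0, fun h => absurd h hi⟩
  have hD : ∀ j, ∃ D, 1 ≤ j → D ∈ Submodule.span ℚ (productTerms x y j) ∧ ∀ k : ℕ,
      Tendsto (fun L : ℕ => ∑ n ∈ Finset.Icc 1 L, (tTerm j (x * y) ((k : ℤ) - n) +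
        tTerm j (x * y) ((k : ℤ) + n)) + tTerm j (x * y) k) atTop (𝓝 D) := fun j => by
    by_cases hj : 1 ≤ j
    · obtain ⟨D, h1, h2⟩ := exists_tendsto_two_sided_t hx0 hy0 rfl hw1 hj
      exact ⟨D, fun _ => ⟨h1, h2⟩⟩
    · exact ⟨0, fun h => absurd h hj⟩
  choose B hB using hB
  choose D hD using hD
  -- Since i ≤ p, the weight p + q - i is at least q and equals 1 only if q = 1; symmetrically for
  -- `htx`.
  have hty : ∀ i ∈ Finset.Icc 1 p, (((p + q - i : ℕ), y) : ℕ × ℂ) ≠ (1, 1) := by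
    intro i hi h
    rw [Finset.mem_Icc] at hi
    obtain ⟨h1, h2⟩ := Prod.ext_iff.mp h
    simp only at h1 h2
    exact hqy (by rw [h2, show q = 1 by omega])
  have htx : ∀ j ∈ Finset.Icc 1 q, (((p + q - j : ℕ), x⁻¹) : ℕ × ℂ) ≠ (1, 1) := by
    intro i hi h
    rw [Finset.mem_Icc] at hi
    obtain ⟨h1, h2⟩ := Prod.ext_iff.mp h
    simp only [inv_eq_one] at h1 h2
    exact hpx (by rw [h2, show p = 1 by omega])
  have htw : ((p + q, y) : ℕ × ℂ) ≠ (1, 1) := fun h => by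
    have := (Prod.ext_iff.mp h).1
    simp only at this
    omega
  have ey : y = x ^ (0 : ℤ) * y ^ (1 : ℤ) := by simp
  have ex : x⁻¹ = x ^ (-1 : ℤ) * y ^ (0 : ℤ) := by simp
  refine ⟨∑ i ∈ Finset.Icc 1 p, (c i : ℂ) * (cycT (p + q - i) y * B i) +
      ∑ j ∈ Finset.Icc 1 q, (d j : ℂ) * (cycT (p + q - j) x⁻¹ * D j - cycT (p + q) y),
    Submodule.add_mem _ (Submodule.sum_mem _ fun i hi => ratCast_mul_mem_span _ ?_)
      (Submodule.sum_mem _ fun j hj => ratCast_mul_mem_span _ (Submodule.sub_mem _ ?_ ?_)),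
    fun M => ∑ k ∈ Finset.Icc 1 M,
      (∑ i ∈ Finset.Icc 1 p, (c i : ℂ) * tTerm (p + q - i) y k * B i +
      ∑ j ∈ Finset.Icc 1 q, (d j : ℂ) * tTerm (p + q - j) x⁻¹ k *
        (D j - tTerm j (x * y) k)), fun M => ?_, ?_⟩
  · have h := hty i hi
    rw [Finset.mem_Icc] at hi
    have e : p + q = (p + q - i) + i := by omega
    have hm : cycT (p + q - i) y ∈ Submodule.span ℚ (productTerms x y (p + q - i)) := by
      have := cycT_mem_span_productTerms (x := x) (y := y) (k := p + q - i) (by omega) 0 1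
        (by rwa [← ey])
      rwa [← ey] at this
    have := mul_mem_span_productTerms hx0 hy0 hm (hB i hi.1).1
    rwa [← e] at this
  · have h := htx j hj
    rw [Finset.mem_Icc] at hj
    have e : p + q = (p + q - j) + j := by omega
    have hm : cycT (p + q - j) x⁻¹ ∈ Submodule.span ℚ (productTerms x y (p + q - j)) := by
      have := cycT_mem_span_productTerms (x := x) (y := y) (k := p + q - j) (by omega) (-1) 0
        (by rwa [← ex])
      rwa [← ex] at this
    have := mul_mem_span_productTerms hx0 hy0 hm (hD j hj.1).1
    rwa [← e] at this
  · have := cycT_mem_span_productTerms (x := x) (y := y) (k := p + q) (by omega) 0 1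
      (by rwa [← ey])
    rwa [← ey] at this
  · simp only [stripSum_eq hx0 hy0 hcd]
    refine tendsto_finsetSum _ fun k _ => (tendsto_finsetSum _ fun i hi => ?_).add
      (tendsto_finsetSum _ fun j hj => ?_)
    · exact (hB i (Finset.mem_Icc.mp hi).1).2.const_mul _
    · exact (((hD j (Finset.mem_Icc.mp hj).1).2 k).sub_const _).const_mul _
  · refine Tendsto.congr (f₁ := fun M =>
      ∑ i ∈ Finset.Icc 1 p, (c i : ℂ) * (tPartial M (p + q - i) y * B i) +
        ∑ j ∈ Finset.Icc 1 q, (d j : ℂ) *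
          (tPartial M (p + q - j) x⁻¹ * D j - tPartial M (p + q) y)) (fun M => ?_)
      ((tendsto_finsetSum _ fun i hi => ?_).add (tendsto_finsetSum _ fun j hj => ?_))
    rotate_left
    · refine ((convergesFast_tPartial hy ?_ (hty i hi)).tendsto.mul_const _).const_mul _
      rw [Finset.mem_Icc] at hi
      omega
    · refine (((convergesFast_tPartial (by simp [hx]) ?_ (htx j hj)).tendsto.mul_const _).sub
        (convergesFast_tPartial hy (by omega) htw).tendsto).const_mul _
      rw [Finset.mem_Icc] at hj
      omega
    simp only [tPartial_eq_sum_tTerm]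
    rw [Finset.sum_add_distrib, Finset.sum_comm (s := Finset.Icc 1 M),
      Finset.sum_comm (s := Finset.Icc 1 M)]
    congr 1
    · refine Finset.sum_congr rfl fun i _ => ?_
      rw [Finset.sum_mul, Finset.mul_sum]
      exact Finset.sum_congr rfl fun k _ => by ring
    · refine Finset.sum_congr rfl fun j hj => ?_
      rw [Finset.sum_mul, ← Finset.sum_sub_distrib, Finset.mul_sum]
      refine Finset.sum_congr rfl fun k _ => ?_
      -- The subtracted n = 0 terms recombine, with argument x⁻¹ · xy = y, into ti_{p+q}(y).
      have e : tTerm (p + q) y k = tTerm (p + q - j) x⁻¹ k * tTerm j (x * y) k := by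
        rw [Finset.mem_Icc] at hj
        unfold tTerm
        rw [div_mul_div_comm, ← pow_add, ← mul_zpow, inv_mul_cancel_left₀ hx0,
          Nat.sub_add_cancel (by omega)]
      rw [e]
      ring

/-! ### The strip sum by columns and the parity relation. -/

theorem norm_pow_div_pow_le {x : ℂ} (hx : ‖x‖ = 1) {p : ℕ} (hp : 1 ≤ p) (n : ℕ) (hn : 1 ≤ n) :
    ‖x ^ n / (n : ℂ) ^ p‖ ≤ 1 / (n : ℝ) := by
  rw [norm_div, norm_pow, norm_pow, hx, one_pow, Complex.norm_natCast]
  have h1 : (1 : ℝ) ≤ n := by exact_mod_cast hn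
  exact one_div_le_one_div_of_le (by linarith) (le_self_pow₀ h1 (by omega))

theorem stripSum_eq_sum_tPartial {y : ℂ} (hy : y ≠ 0) (L M p q : ℕ) (x : ℂ) :
    stripSum L M p q x y =
      (-1) ^ q * y * (∑ n ∈ Finset.Icc 1 L, x⁻¹ ^ n / (n : ℂ) ^ p * tPartial n q y⁻¹ -
        ∑ n ∈ Finset.Icc 1 L, x⁻¹ ^ n / (n : ℂ) ^ p * tPartial (n - M) q y⁻¹) +
      ∑ n ∈ Finset.Icc 1 L, x⁻¹ ^ n / (n : ℂ) ^ p * tPartial (M - n) q y +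
      (-1) ^ p * (∑ n ∈ Finset.Icc 1 L, x ^ n / (n : ℂ) ^ p * tPartial (n + M) q y -
        ∑ n ∈ Finset.Icc 1 L, x ^ n / (n : ℂ) ^ p * tPartial n q y) := by
  unfold stripSum
  rw [Finset.sum_comm]
  simp only [Finset.sum_add_distrib, ← Finset.mul_sum, sum_tTerm_block hy, sum_tTerm_shift]
  simp only [Finset.mul_sum, ← Finset.sum_sub_distrib, ← Finset.sum_add_distrib]
  exact Finset.sum_congr rfl fun n _ => by ring

/-- The region n₁ < n₂ is the full square minus n₂ ≤ n₁; the powers of 2 come out of the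
denominators. -/
theorem doubleSPartial_eq (N p q : ℕ) (x y : ℂ) :
    doubleSPartial N p q x y = ((4 / 2 ^ (p + q) : ℚ) : ℂ) *
      (zetaPartial N p x * tPartial N q y -
        ∑ n ∈ Finset.Icc 1 N, x ^ n / (n : ℂ) ^ p * tPartial n q y) := by
  have e : ∀ n₁ n₂ : ℕ, x ^ n₁ * y ^ n₂ / ((2 * (n₁ : ℂ)) ^ p * (2 * (n₂ : ℂ) - 1) ^ q) =
      1 / 2 ^ (p + q) * (x ^ n₁ / (n₁ : ℂ) ^ p * tTerm q y n₂) := by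
    intro n₁ n₂
    unfold tTerm
    rw [show 2 * (n₂ : ℂ) - 1 = 2 * (((n₂ : ℤ) : ℂ) - 1 / 2) by push_cast; ring, mul_pow, mul_pow,
      pow_add, div_mul_div_comm, div_mul_div_comm, one_mul, zpow_natCast]
    congr 1
    ring
  have key : ∑ n₂ ∈ Finset.Icc 1 N, ∑ n₁ ∈ Finset.Ico 1 n₂, x ^ n₁ / (n₁ : ℂ) ^ p * tTerm q y n₂ =
      zetaPartial N p x * tPartial N q y -
        ∑ n ∈ Finset.Icc 1 N, x ^ n / (n : ℂ) ^ p * tPartial n q y := by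
    induction N with
    | zero => simp [zetaPartial]
    | succ N ih =>
      rw [Finset.sum_Icc_succ_top (by omega), ih, Finset.sum_Icc_succ_top (by omega),
        Finset.Ico_add_one_right_eq_Icc, ← Finset.sum_mul, tPartial_succ]
      unfold zetaPartial
      rw [Finset.sum_Icc_succ_top (by omega)]
      push_cast
      ring
  unfold doubleSPartial
  simp only [e, ← Finset.mul_sum]
  rw [key]
  push_cast
  ring

theorem exists_tendsto_doubleSPartial {x y : ℂ} (hx : ‖x‖ = 1) (hy : ‖y‖ = 1) {p q : ℕ}
    (hp : 1 ≤ p) (hq : 1 ≤ q) (hpx : ((p, x) : ℕ × ℂ) ≠ (1, 1)) (hqy : ((q, y) : ℕ × ℂ) ≠ (1, 1)) :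
    ∃ U, Tendsto (fun N : ℕ => ∑ n ∈ Finset.Icc 1 N, x ^ n / (n : ℂ) ^ p * tPartial n q y)
        atTop (𝓝 U) ∧
      Tendsto (fun N => doubleSPartial N p q x y) atTop (𝓝 (doubleS p q x y)) ∧
      doubleS p q x y = ((4 / 2 ^ (p + q) : ℚ) : ℂ) * (cycZeta p x * cycT q y - U) := by
  have hz := (convergesFast_zetaPartial hx hp hpx).tendsto
  have ht := convergesFast_tPartial hy hq hqy
  obtain ⟨U, hU⟩ := exists_tendsto_sum_mul (norm_pow_div_pow_le hx hp) hz ht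
  have h := ((hz.mul ht.tendsto).sub hU).const_mul ((4 / 2 ^ (p + q) : ℚ) : ℂ)
  simp only [← doubleSPartial_eq] at h
  have e : doubleS p q x y = _ := h.limUnder_eq
  exact ⟨U, hU, by rwa [e], e⟩

theorem mainTheorem7 (x y : ℂ) (p q : ℕ)
    (hx : ∃ n : ℕ, 0 < n ∧ x ^ n = 1) (hy : ∃ n : ℕ, 0 < n ∧ y ^ n = 1)
    (hp : 1 ≤ p) (hq : 1 ≤ q)
    (hpx : ((p, x) : ℕ × ℂ) ≠ (1, 1)) (hqy : ((q, y) : ℕ × ℂ) ≠ (1, 1)) :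
    Tendsto (fun N : ℕ => doubleSPartial N p q x y) atTop (𝓝 (doubleS p q x y)) ∧
    Tendsto (fun N : ℕ => doubleSPartial N p q x⁻¹ y⁻¹) atTop (𝓝 (doubleS p q x⁻¹ y⁻¹)) ∧
    doubleS p q x y - (-1) ^ (p + q) * y * doubleS p q x⁻¹ y⁻¹ ∈
      Submodule.span ℚ (productTerms x y (p + q)) := by
  have norm_eq : ∀ {z : ℂ}, (∃ n : ℕ, 0 < n ∧ z ^ n = 1) → ‖z‖ = 1 := by
    rintro z ⟨n, hn, h⟩
    exact Complex.norm_eq_one_of_pow_eq_one h hn.ne'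
  have hx1 := norm_eq hx
  have hy1 := norm_eq hy
  have hx1' : ‖x⁻¹‖ = 1 := by simp [hx1]
  have hy1' : ‖y⁻¹‖ = 1 := by simp [hy1]
  have hx0 : x ≠ 0 := norm_pos_iff.mp (by rw [hx1]; exact one_pos)
  have hy0 : y ≠ 0 := norm_pos_iff.mp (by rw [hy1]; exact one_pos)
  have hpx' := pair_ne_of_inv hpx
  have hqy' := pair_ne_of_inv hqy
  obtain ⟨U, hU, hS, eS⟩ := exists_tendsto_doubleSPartial hx1 hy1 hp hq hpx hqy
  obtain ⟨V, hV, hS', eS'⟩ := exists_tendsto_doubleSPartial hx1' hy1' hp hq hpx' hqy'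
  refine ⟨hS, hS', ?_⟩
  obtain ⟨Q, hQ, F, hF, hFQ⟩ := exists_tendsto_stripSum hx1 hy1 hp hq hpx hqy
  -- L(M) is large enough that the strip sum is within 1/(M+1) of its row limit, so the diagonal
  -- sequence tends to Q.
  have hL : ∀ M : ℕ, ∃ L, M ≤ L ∧ dist (stripSum L M p q x y) (F M) < 1 / ((M : ℝ) + 1) :=
    fun M => ((eventually_ge_atTop M).and
      (Metric.tendsto_nhds.mp (hF M) _ (by positivity))).exists
  choose L hML hLF using hL
  have h1 : Tendsto (fun M => stripSum (L M) M p q x y) atTop (𝓝 Q) :=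
    (tendsto_iff_of_dist (squeeze_zero (fun _ => dist_nonneg) (fun M => (hLF M).le)
      tendsto_one_div_add_atTop_nhds_zero_nat)).mpr hFQ
  have hLtop : Tendsto L atTop atTop := tendsto_atTop_mono hML tendsto_id
  have hz := (convergesFast_zetaPartial hx1 hp hpx).tendsto
  have hz' := (convergesFast_zetaPartial hx1' hp hpx').tendsto
  have ht := convergesFast_tPartial hy1 hq hqy
  have ht' := convergesFast_tPartial hy1' hq hqy'
  have ha := norm_pow_div_pow_le hx1 hp
  have ha' := norm_pow_div_pow_le hx1' hp
  have h2 : Tendsto (fun M => stripSum (L M) M p q x y) atTop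
      (𝓝 ((-1) ^ q * y * (V - 0) + cycZeta p x⁻¹ * cycT q y +
        (-1) ^ p * (cycZeta p x * cycT q y - U))) := by
    simp only [stripSum_eq_sum_tPartial hy0]
    exact ((((hV.comp hLtop).sub
      (tendsto_sum_mul_sub ha' hz' ht' (by simp [tPartial]) hML)).const_mul _).add
      (tendsto_sum_mul_reflect ha' hz' ht (by simp [tPartial]) hML)).add
      (((tendsto_sum_mul_add ha hz ht hML).sub (hU.comp hLtop)).const_mul _)
  have hQeq := tendsto_nhds_unique h1 h2
  have ex : x = x ^ (1 : ℤ) * y ^ (0 : ℤ) := by simp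
  have ex' : x⁻¹ = x ^ (-1 : ℤ) * y ^ (0 : ℤ) := by simp
  have ey : y = x ^ (0 : ℤ) * y ^ (1 : ℤ) := by simp
  have ey' : y⁻¹ = x ^ (0 : ℤ) * y ^ (-1 : ℤ) := by simp
  have mT : cycT q y ∈ Submodule.span ℚ (productTerms x y q) := by
    have := cycT_mem_span_productTerms (x := x) (y := y) hq 0 1 (by rwa [← ey])
    rwa [← ey] at this
  have mT' : cycT q y⁻¹ ∈ Submodule.span ℚ (productTerms x y q) := by
    have := cycT_mem_span_productTerms (x := x) (y := y) hq 0 (-1) (by rwa [← ey'])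
    rwa [← ey'] at this
  have mZ' : cycZeta p x⁻¹ ∈ Submodule.span ℚ (productTerms x y p) := by
    have := cycZeta_mem_span_productTerms (x := x) (y := y) hp (-1) 0 (by rwa [← ex'])
    rwa [← ex'] at this
  have mY : y ∈ Submodule.span ℚ (productTerms x y 0) := by
    have := monomial_mem_span_productTerms (x := x) (y := y) 0 1
    rwa [← ey] at this
  have m1 := mul_mem_span_productTerms hx0 hy0 mZ' mT
  have m2 := mul_mem_span_productTerms hx0 hy0 mY (mul_mem_span_productTerms hx0 hy0 mZ' mT')
  rw [zero_add] at m2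
  -- Solve the column limit for U and V: (-1)^p (Q - Li_p(x⁻¹) ti_q(y)) contains both, and only
  -- products of single values remain.
  have e : doubleS p q x y - (-1) ^ (p + q) * y * doubleS p q x⁻¹ y⁻¹ =
      ((4 / 2 ^ (p + q) : ℚ) : ℂ) * ((-1) ^ p * (Q - cycZeta p x⁻¹ * cycT q y) -
        (-1) ^ (p + q) * (y * (cycZeta p x⁻¹ * cycT q y⁻¹))) := by
    rw [eS, eS', hQeq, pow_add (-1 : ℂ)]
    have hs : ((-1 : ℂ) ^ p) * (-1) ^ p = 1 := by rw [← mul_pow]; simp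
    generalize (-1 : ℂ) ^ p = s at hs ⊢
    linear_combination (-(((4 / 2 ^ (p + q) : ℚ) : ℂ) * (cycZeta p x * cycT q y - U))) * hs
  rw [e]
  exact ratCast_mul_mem_span _ (Submodule.sub_mem _
    (neg_one_pow_mul_mem_span _ (Submodule.sub_mem _ hQ m1)) (neg_one_pow_mul_mem_span _ m2))
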